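/- Binary strings are the elements of $\{0,1\}^*=\bigcup_{m\ge 0}\{0,1\}^m$, with empty string $\lambda$ and concatenation $\otimes$. A computer is a partial recursive function $C:\{0,1\}^*\to\{0,1\}^*$; write $C(x)=\infty$ if $C$ does not halt on $x$, and put $\overline{\{0,1\}^*}=\{0,1\}^*\cup\{\infty\}$. For a computer $C$ and a string $x$ let $(C\stackrel{x}{\to})$ be the computer $D$ with $D(s)=C(x\otimes s)$ for all $s$, and write $C\stackrel{x}{\to}D$ for $D=(C\stackrel{x}{\to})$. A set $\Phi$ of computers is branching if for every $C\in\Phi$: $(C\stackrel{x\otimes y}{\longrightarrow})\in\Phi$ implies $(C\stackrel{x}{\to})\in\Phi$ for all strings $x,y$; and $(C\stackrel{x}{\to})\in\Phi$ for some $x\ne\lambda$. In that case let $C^{-1}(\Phi)=\{x : (C\stackrel{x}{\to})\in\Phi\}$, and define the path probability on this tree by $\mu_{C^{-1}(\Phi)}(\lambda)=1$ and, for a bit $b$ with $x\otimes b\in C^{-1}(\Phi)$, $\mu_{C^{-1}(\Phi)}(x\otimes b)=\frac12\mu_{C^{-1}(\Phi)}(x)$ if also $x\otimes\bar b\in C^{-1}(\Phi)$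 (where $\bar b$ is the other bit), and $\mu_{C^{-1}(\Phi)}(x\otimes b)=\mu_{C^{-1}(\Phi)}(x)$ otherwise. For $C,D\in\Phi$, $s\in\overline{\{0,1\}^*}$ and $m\ge 0$ put $$\mu_C^{(m)}(D|\Phi)=\sum_{x\in\{0,1\}^m:\,C\stackrel{x}{\to}D}\mu_{C^{-1}(\Phi)}(x),\qquad \mu_C^{(m)}(s|\Phi)=\sum_{x\in\{0,1\}^m\cap C^{-1}(\Phi):\,C(x)=s}\mu_{C^{-1}(\Phi)}(x).$$ The numbers $\mu_C^{(m)}(D|\Phi)$ are the $m$-step transition probabilities of a Markov chain on $\Phi$, the random walk on the tree. Call $\Phi$ positive recurrent if it is nonempty and branching and this Markov chain is irreducible, aperiodic and positive recurrent (started in any state, it returns to that state almost surely and with finite expected return time). $\Phi$ is complete if, whenever $C\in\Phi$, $k\in\mathbb N$ and $D$ is a computer with $D(x)=C(x)$ for all strings $x$ of length $|x|\ge k$, also $D\in\Phi$. Let $\sigma$ be a permutation of $\{0,1\}^k$ such that for at least one $x\in\{0,1\}^k$ the first bits of $x$ and $\sigma(x)$ differ. For a string $s$ let $\mathcal I_\sigma(s)$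 be obtained by applying $\sigma$ to the last $k$ bits of $s$ (with $\mathcal I_\sigma(s)=s$ if $|s|<k$), and for a computer $C$ let $\mathcal I_\sigma(C)$ be the computer $s\mapsto C(\mathcal I_\sigma(s))$. The map $C\mapsto \mathcal I_\sigma(C)$ is called an input transformation of order $|\sigma|=k$. $\Phi$ is closed under it if $\mathcal I_\sigma(C)\in\Phi$ for all $C\in\Phi$. For a computer $U$, $n\ge0$ and $s\in\overline{\{0,1\}^*}$ the output frequency is $\mu_U^{(n)}(s)=2^{-n}\,\#\{x\in\{0,1\}^n : U(x)=s\}$. **Theorem.** Let $n\ge 0$ and let $\Phi$ be a set of computers that is positive recurrent, complete, and closed under every input transformation $\mathcal I_\sigma$ of order $|\sigma|\le n$. Then for all $U\in\Phi$ and $s\in\overline{\{0,1\}^*}$ the limits $$\mu(U|\Phi)=\lim_{m\to\infty}\mu_C^{(m)}(U|\Phi),\qquad \mu(s|\Phi)=\lim_{m\to\infty}\mu_C^{(m)}(s|\Phi)$$ exist and do not depend on $C\in\Phi$, and for every $s\in\overline{\{0,1\}^*}$ $$\mu(s|\Phi)=\sum_{U\in\Phi}\mu(U|\Phi)\,\mu_U^{(n)}(s).$$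 -/

import Mathlib

open Filter Topology

noncomputable section

namespace StationaryAlgProb

/-- Finite binary strings; `[]` is the empty string and `++` is concatenation. -/
abbrev Str : Type := List Bool

/-- A computer: a partial recursive function from strings to strings. The value `Part.none`
means that the computer does not halt, so `Part Str` is the set of strings together with `∞`. -/
@[ext]
structure Computer where
  toFun : Str →. Str
  partrec : Partrec toFun

instance : CoeFun Computer fun _ => Str → Part Str := ⟨Computer.toFun⟩

/-- The computer `D` with `C ⟶ˣ D`, i.e. `D(s) = C(x ⊗ s)` for every string `s`.
Thus `C` emulates `D` via `x` if and only if `C.after x = D`. -/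
def Computer.after (C : Computer) (x : Str) : Computer where
  toFun s := C (x ++ s)
  partrec := C.partrec.comp (Computable.list_append.comp (Computable.const x) Computable.id)

/-- `Φ` is branching. -/
structure IsBranching (Φ : Set Computer) : Prop where
  prefix_mem : ∀ C ∈ Φ, ∀ x y : Str, C.after (x ++ y) ∈ Φ → C.after x ∈ Φ
  exists_mem : ∀ C ∈ Φ, ∃ x : Str, x ≠ [] ∧ C.after x ∈ Φ

/-- The `Φ`-tree of `C`: the inputs that make `C` emulate a computer in `Φ`. -/
def tree (Φ : Set Computer) (C : Computer) : Set Str := {x | C.after x ∈ Φ}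

open Classical in
/-- Auxiliary recursion for `pathProb`; the argument is the path in reversed order. -/
def pathProbRev (T : Set Str) : Str → ℝ
  | [] => 1
  | b :: r => if r.reverse ++ [!b] ∈ T then pathProbRev T r / 2 else pathProbRev T r

/-- The path probability of `x` in the tree `T`, see `pathProb_nil` and `pathProb_concat`.
It is only used for `x ∈ T`. -/
def pathProb (T : Set Str) (x : Str) : ℝ := pathProbRev T x.reverse

theorem pathProb_nil (T : Set Str) : pathProb T [] = 1 := rfl

open Classical in
theorem pathProb_concat (T : Set Str) (x : Str) (b : Bool) :
    pathProb T (x ++ [b]) = if x ++ [!b] ∈ T then pathProb T x / 2 else pathProb T x := by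
  simp [pathProb, pathProbRev]

open Classical in
/-- The `n`-step computer probability `μ_C^{(n)}(D|Φ)`. -/
def stepProb (Φ : Set Computer) (n : ℕ) (C D : Computer) : ℝ :=
  ∑ x : List.Vector Bool n with C.after x.toList = D, pathProb (tree Φ C) x.toList

open Classical in
/-- The `n`-step string probability `μ_C^{(n)}(s|Φ)`. -/
def stepStringProb (Φ : Set Computer) (n : ℕ) (C : Computer) (s : Part Str) : ℝ :=
  ∑ x : List.Vector Bool n with x.toList ∈ tree Φ C ∧ C x.toList = s,
    pathProb (tree Φ C) x.toList

open Classical in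
/-- The output frequency `μ_C^{(n)}(s)`. -/
def outputFreq (n : ℕ) (C : Computer) (s : Part Str) : ℝ :=
  ((Finset.univ.filter fun x : List.Vector Bool n => C x.toList = s).card : ℝ) / 2 ^ n

open Classical in
/-- The probability that the random walk on the `Φ`-tree of `C`, i.e. the emulation Markov process
started in `C`, returns to the computer `C` for the first time (after time `0`) at time `n`. -/
def firstReturnProb (Φ : Set Computer) (n : ℕ) (C : Computer) : ℝ :=
  ∑ x : List.Vector Bool n with
      0 < n ∧ C.after x.toList = C ∧ ∀ i, 0 < i → i < n → C.after (x.toList.take i) ≠ C,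
    pathProb (tree Φ C) x.toList

/-- The emulation Markov process on `Φ` is irreducible. -/
def IsIrreducible (Φ : Set Computer) : Prop :=
  ∀ C ∈ Φ, ∀ D ∈ Φ, ∃ n : ℕ, 0 < n ∧ 0 < stepProb Φ n C D

/-- The emulation Markov process on `Φ` is aperiodic: every state has period `1`. -/
def IsAperiodic (Φ : Set Computer) : Prop :=
  ∀ C ∈ Φ, Nat.setGcd {n : ℕ | 0 < n ∧ 0 < stepProb Φ n C C} = 1

/-- Every state of the emulation Markov process on `Φ` is positive recurrent: the process started
there returns almost surely, and the expected return time is finite. -/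
def HasPositiveRecurrentStates (Φ : Set Computer) : Prop :=
  ∀ C ∈ Φ, HasSum (fun n : ℕ => firstReturnProb Φ n C) 1 ∧
    Summable fun n : ℕ => (n : ℝ) * firstReturnProb Φ n C

/-- `Φ` is positive recurrent, where it is understood that `Φ` is also (nonempty,) branching,
irreducible and aperiodic. -/
structure IsPositiveRecurrent (Φ : Set Computer) : Prop where
  nonempty : Φ.Nonempty
  branching : IsBranching Φ
  irreducible : IsIrreducible Φ
  aperiodic : IsAperiodic Φ
  recurrent : HasPositiveRecurrentStates Φ

/-- `p` is the limit `lim_{m → ∞} μ_C^{(m)}(D|Φ)` for every starting computer `C ∈ Φ`. -/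
def IsComputerProb (Φ : Set Computer) (D : Computer) (p : ℝ) : Prop :=
  ∀ C ∈ Φ, Tendsto (fun m : ℕ => stepProb Φ m C D) atTop (𝓝 p)

/-- `p` is the limit `lim_{m → ∞} μ_C^{(m)}(s|Φ)` for every starting computer `C ∈ Φ`. -/
def IsStringProb (Φ : Set Computer) (s : Part Str) (p : ℝ) : Prop :=
  ∀ C ∈ Φ, Tendsto (fun m : ℕ => stepStringProb Φ m C s) atTop (𝓝 p)

/-- The stationary computer probability `μ(D|Φ)`: the common limit of the `m`-step computer
probabilities (an arbitrary number if there is no such limit). -/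
def computerProb (Φ : Set Computer) (D : Computer) : ℝ := Classical.epsilon (IsComputerProb Φ D)

/-- The stationary string probability `μ(s|Φ)`: the common limit of the `m`-step string
probabilities (an arbitrary number if there is no such limit). -/
def stringProb (Φ : Set Computer) (s : Part Str) : ℝ := Classical.epsilon (IsStringProb Φ s)

/-- `C` and `D` are `k`-equivalent: they agree on all inputs of length at least `k`. -/
def KEquiv (k : ℕ) (C D : Computer) : Prop := ∀ x : Str, k ≤ x.length → C x = D x

/-- `Φ` is complete: it contains the `k`-equivalence class of each of its members, for every `k`. -/
def IsCompleteComputerSet (Φ : Set Computer) : Prop :=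
  ∀ C ∈ Φ, ∀ (k : ℕ) (D : Computer), KEquiv k C D → D ∈ Φ

/-- Apply the permutation `σ` of `{0,1}^k` to the last `k` bits of a string; strings shorter
than `k` are left unchanged. -/
def inputMap {k : ℕ} (σ : Equiv.Perm (List.Vector Bool k)) (s : Str) : Str :=
  if h : k ≤ s.length then
    s.take (s.length - k) ++
      (σ ⟨s.drop (s.length - k), by rw [List.length_drop]; omega⟩).toList
  else s

theorem primrec_modify_on (g : Str → Str) (L : List Str) :
    Primrec fun t : Str => if t ∈ L then g t else t := by
  induction L with
  | nil => exact Primrec.id.of_eq fun t => by simp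
  | cons a L ih =>
    refine (Primrec.ite (Primrec.eq.comp Primrec.id (Primrec.const a))
      (Primrec.const (g a)) ih).of_eq fun t => ?_
    by_cases h : t = a
    · simp [h]
    · simp [h]

theorem computable_inputMap {k : ℕ} (σ : Equiv.Perm (List.Vector Bool k)) :
    Computable (inputMap σ) := by
  have hlen : Primrec fun s : Str => s.length - k :=
    Primrec.nat_sub.comp Primrec.list_length (Primrec.const k)
  have hb := primrec_modify_on (fun t => if h : t.length = k then (σ ⟨t, h⟩).toList else t)
    ((Finset.univ : Finset (List.Vector Bool k)).toList.map List.Vector.toList)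
  refine Primrec.to_comp ((Primrec.list_append.comp (Primrec.list_take.comp hlen Primrec.id)
    (hb.comp (Primrec.list_drop.comp hlen Primrec.id))).of_eq fun s => ?_)
  have hmem : ∀ t : Str,
      t ∈ (Finset.univ : Finset (List.Vector Bool k)).toList.map List.Vector.toList ↔
        t.length = k := by
    intro t
    simp only [List.mem_map, Finset.mem_toList, Finset.mem_univ, true_and]
    exact ⟨fun ⟨v, hv⟩ => hv ▸ v.toList_length, fun h => ⟨⟨t, h⟩, rfl⟩⟩
  simp only [hmem, id, inputMap]
  by_cases h : k ≤ s.length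
  · have h2 : (s.drop (s.length - k)).length = k := by rw [List.length_drop]; omega
    rw [if_pos h2, dif_pos h2, dif_pos h]
  · have h2 : ¬ (s.drop (s.length - k)).length = k := by rw [List.length_drop]; omega
    rw [if_neg h2, dif_neg h, List.take_append_drop]

/-- `σ` changes the first bit of at least one string: the condition under which the permutation
`σ` of `{0,1}^k` defines an input transformation (never satisfied for `k = 0`). -/
def ChangesFirstBit {k : ℕ} (σ : Equiv.Perm (List.Vector Bool k)) : Prop :=
  ∃ x : List.Vector Bool k, x.toList.head? ≠ (σ x).toList.head?

/-- The transformed computer `I_σ(C)`, given by `(I_σ(C))(s) = C(I_σ(s))`. -/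
def inputTransform {k : ℕ} (σ : Equiv.Perm (List.Vector Bool k)) (C : Computer) : Computer where
  toFun s := C (inputMap σ s)
  partrec := C.partrec.comp (computable_inputMap σ)

/-- `Φ` is closed with respect to every input transformation of order at most `n`. -/
def ClosedUnderInputTransforms (n : ℕ) (Φ : Set Computer) : Prop :=
  ∀ k ≤ n, ∀ σ : Equiv.Perm (List.Vector Bool k), ChangesFirstBit σ →
    ∀ C ∈ Φ, inputTransform σ C ∈ Φ

end StationaryAlgProb

end

open StationaryAlgProb

/-! The walk on the tree of `C` induces a Markov chain on `Φ`, and the proof rests on two facts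
about it.

Convergence: for bounded `g`, the mean of `g` after `m` steps tends to a limit independent of the
starting computer, and this limit is the sum of `g` against the limits for point masses
(`RandomWalk.tendsto_avg_iterate`, `hasSum_excursionMean`). Splitting the walk at its returns to a
fixed state `d` gives a renewal equation, so the renewal theorem `tendsto_of_renewal_eq` yields the
limit as a quotient of sums over one excursion from `d`; that formula is visibly a measure in `g`.

Symmetry: completeness and closure force `D` and `I_σ(D)` to have the same tree for `σ` of order `n`
(`tree_inputTransform`). Starting from `I_σ(D)` thus amounts to walking from `D` and permuting the
last `n` bits before the output is read. The limit ignores the start, so every `σ` gives the same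
`μ(s|Φ)`. Averaged over all `σ`, the last `n` bits become uniform whatever the path weights were,
and the output frequency appears (`sum_perm_pathMean`). -/

open Filter Topology
-- The discrete renewal theorem
namespace Renewal

open Finset

variable {f a q : ℕ → ℝ}

/-- The tail `∑_{j ≥ k} f j` of a probability distribution `f`. -/
noncomputable def tail (f : ℕ → ℝ) (k : ℕ) : ℝ := 1 - ∑ j ∈ range k, f j

theorem tail_nonneg (hf0 : ∀ k, 0 ≤ f k) (hf : HasSum f 1) (k : ℕ) : 0 ≤ tail f k :=
  sub_nonneg.2 (sum_le_hasSum _ (fun i _ => hf0 i) hf)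

/-- Summing tails counts `f j` once for each `k ≤ j`, that is `j + 1` times, so the partial sums are
bounded by the mean waiting time. -/
theorem summable_tail (hf0 : ∀ k, 0 ≤ f k) (hf : HasSum f 1)
    (hfm : Summable fun k : ℕ => ((k : ℝ) + 1) * f k) : Summable (tail f) := by
  refine summable_of_sum_range_le (c := ∑' k : ℕ, ((k : ℝ) + 1) * f k)
    (tail_nonneg hf0 hf) fun n => ?_
  have h : ∀ k, HasSum (fun j => if k ≤ j then f j else 0) (tail f k) := by
    intro k
    have h1 : HasSum (fun j => if j < k then f j else 0) (∑ j ∈ range k, f j) := by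
      have h0 : ∑ j ∈ range k, f j = ∑ j ∈ range k, if j < k then f j else 0 :=
        sum_congr rfl fun j hj => by rw [if_pos (mem_range.1 hj)]
      rw [h0]
      exact hasSum_sum_of_ne_finset_zero fun j hj => if_neg fun h => hj (mem_range.2 h)
    have h2 : (fun j => if k ≤ j then f j else 0) = fun j => f j - if j < k then f j else 0 := by
      funext j
      by_cases hj : j < k
      · simp [hj, not_le.2 hj]
      · simp [hj, not_lt.1 hj]
    rw [h2]
    exact hf.sub h1
  have h2 := hasSum_sum (s := range n) (fun k _ => h k)
  refine hasSum_le (fun j => ?_) h2 hfm.hasSum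
  rw [← sum_filter, sum_const, nsmul_eq_mul]
  refine mul_le_mul_of_nonneg_right ?_ (hf0 j)
  have : (filter (fun k => k ≤ j) (range n)).card ≤ (range (j + 1)).card :=
    card_le_card fun k hk => mem_range.2 (Nat.lt_succ_of_le (mem_filter.1 hk).2)
  rw [card_range] at this
  exact_mod_cast this

/-- Since `tail f (i + 1) = tail f i - f i`, the renewal equation makes the convolution on the left
grow by exactly `q (n + 1)` at each step. -/
theorem sum_tail_mul (ha : ∀ n, a n = q n + ∑ k ∈ range n, f k * a (n - 1 - k)) (n : ℕ) :
    ∑ i ∈ range (n + 1), tail f i * a (n - i) = ∑ i ∈ range (n + 1), q i := by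
  induction n with
  | zero =>
    have h0 : a 0 = q 0 := by simpa using ha 0
    simp [tail, h0]
  | succ n ih =>
    rw [sum_range_succ', sum_range_succ q, ← ih]
    have h1 : ∀ i, tail f (i + 1) = tail f i - f i := fun i => by
      simp only [tail, sum_range_succ]; ring
    simp only [h1, Nat.add_sub_add_right, sub_mul, sum_sub_distrib, Nat.sub_zero]
    have h2 := ha (n + 1)
    simp only [Nat.add_sub_cancel] at h2
    rw [h2]
    simp [tail]

/-- Dominated convergence with majorant `r i * B`. A general filter `ω` is allowed so that
ultrafilters can be used. -/
theorem tendsto_sum_range_mul {r : ℕ → ℝ} {v : ℕ → ℝ} {B : ℝ} (hr : Summable r)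
    (hr0 : ∀ k, 0 ≤ r k) (hB : ∀ n, |a n| ≤ B) {ω : Filter ℕ} (hω : ω ≤ atTop) (K c : ℕ)
    (hv : ∀ k, Tendsto (fun n => a (n - k)) ω (𝓝 (v k))) :
    Tendsto (fun n => ∑ i ∈ range (n - c), r i * a (n - K - i)) ω (𝓝 (∑' i, r i * v (K + i))) := by
  have hB0 : 0 ≤ B := (abs_nonneg _).trans (hB 0)
  have h1 : ∀ n, ∑ i ∈ range (n - c), r i * a (n - K - i)
      = ∑' i, if i < n - c then r i * a (n - K - i) else 0 := by
    intro n
    rw [tsum_eq_sum (s := range (n - c)) (fun i hi => by simp only [mem_range] at hi; simp [hi])]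
    exact sum_congr rfl fun i hi => by simp [mem_range.1 hi]
  simp only [h1]
  refine tendsto_tsum_of_dominated_convergence (hr.mul_right B) (fun i => ?_)
    (Eventually.of_forall fun n i => ?_)
  · have h2 : ∀ᶠ n in ω, c + i + 1 ≤ n := hω (eventually_ge_atTop _)
    refine ((hv (K + i)).const_mul (r i)).congr' ?_
    filter_upwards [h2] with n hn
    rw [if_pos (by omega), Nat.sub_sub]
  · split_ifs
    · rw [Real.norm_eq_abs, abs_mul, abs_of_nonneg (hr0 i)]
      exact mul_le_mul_of_nonneg_left (hB _) (hr0 i)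
    · simpa using mul_nonneg (hr0 i) hB0

/-- Along an ultrafilter with `a → l`, every backward shift of `a` converges too, to some `v k ≤ l`.
In the limit `v k` is an `f`-average of later values, so the maximal value `v 0 = l` spreads to
every index in the semigroup generated by the waiting times, hence to all indices from `K` on. The
identity `sum_tail_mul` then determines `l`. -/
theorem greatest_cluster_point (hf0 : ∀ k, 0 ≤ f k) (hf : HasSum f 1)
    (hfm : Summable fun k : ℕ => ((k : ℝ) + 1) * f k) {K : ℕ}
    (hK : ∀ n ≥ K, n ∈ AddSubmonoid.closure {m | ∃ j, m = j + 1 ∧ 0 < f j})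
    {B : ℝ} (hB : ∀ n, |a n| ≤ B) (hq : Summable q)
    (ha : ∀ n, a n = q n + ∑ k ∈ range n, f k * a (n - 1 - k)) {l : ℝ}
    (hl : MapClusterPt l atTop a) (hmax : ∀ l', MapClusterPt l' atTop a → l' ≤ l) :
    l * ∑' k, tail f k = ∑' k, q k := by
  obtain ⟨ω, hω, hωl⟩ := mapClusterPt_iff_ultrafilter.1 hl
  have hshift : ∀ k, Tendsto (fun n : ℕ => n - k) ω atTop := fun k =>
    (tendsto_sub_atTop_nat k).mono_left hω
  have hex : ∀ k, ∃ v, Tendsto (fun n => a (n - k)) ω (𝓝 v) := by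
    intro k
    obtain ⟨v, -, hv⟩ := (isCompact_Icc (a := -B) (b := B)).ultrafilter_le_nhds
      (ω.map fun n : ℕ => a (n - k)) (by
        rw [le_principal_iff, Ultrafilter.coe_map, Filter.mem_map]
        exact Filter.univ_mem' fun n => abs_le.1 (hB (n - k)))
    exact ⟨v, hv⟩
  choose v hv using hex
  have hvl : ∀ k, v k ≤ l := fun k => hmax _ <| by
    have : Tendsto a (map (fun n => n - k) ω) (𝓝 (v k)) := tendsto_map'_iff.2 (hv k)
    exact (this.mapClusterPt).mono (hshift k)
  have hv0 : v 0 = l := tendsto_nhds_unique (hv 0) (by simpa using hωl)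
  have hrec : ∀ k, v k = ∑' j, f j * v (k + 1 + j) := by
    intro k
    have h1 := tendsto_sum_range_mul hf.summable hf0 hB hω (k + 1) k hv
    have h2 := ((hq.tendsto_atTop_zero.comp (hshift k)).add h1)
    rw [zero_add] at h2
    refine tendsto_nhds_unique (hv k) (h2.congr fun n => ?_)
    rw [ha (n - k)]
    simp only [Function.comp, Nat.sub_sub]
  have hBv : ∀ k, |v k| ≤ B := fun k =>
    le_of_tendsto (hv k).abs (Eventually.of_forall fun n => hB _)
  have hstep : ∀ k, v k = l → ∀ j, 0 < f j → v (k + 1 + j) = l := by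
    intro k hk j hj
    have hs : Summable fun j => f j * v (k + 1 + j) :=
      Summable.of_norm_bounded (hf.summable.mul_right B) fun j => by
        rw [Real.norm_eq_abs, abs_mul, abs_of_nonneg (hf0 j)]
        exact mul_le_mul_of_nonneg_left (hBv _) (hf0 j)
    have h1 : HasSum (fun j => f j * (l - v (k + 1 + j))) 0 := by
      have := (hf.mul_right l).sub hs.hasSum
      rw [← hrec k, hk, one_mul, sub_self] at this
      simpa only [mul_sub] using this
    have h2 := (hasSum_zero_iff_of_nonneg
      (fun j => mul_nonneg (hf0 j) (sub_nonneg.2 (hvl _)))).1 h1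
    have h3 := congrFun h2 j
    simp only [Pi.zero_apply, mul_eq_zero, hj.ne', false_or] at h3
    linarith
  have hclosure : ∀ m ∈ AddSubmonoid.closure {m | ∃ j, m = j + 1 ∧ 0 < f j},
      ∀ k, v k = l → v (k + m) = l := by
    intro m hm
    induction hm using AddSubmonoid.closure_induction with
    | mem m hm =>
      obtain ⟨j, rfl, hj⟩ := hm
      intro k hk
      have := hstep k hk j hj
      rwa [add_right_comm] at this
    | zero => intro k hk; simpa using hk
    | add m n _ _ hm hn =>
      intro k hk
      rw [← add_assoc]
      exact hn _ (hm _ hk)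
  have hvK : ∀ i, v (K + i) = l := fun i => by
    simpa using hclosure (K + i) (hK _ (by omega)) 0 hv0
  have h1 := tendsto_sum_range_mul (summable_tail hf0 hf hfm) (tail_nonneg hf0 hf) hB hω K K hv
  -- `sum_tail_mul` has one more term on each side, `tail f (n - K) * a 0` and `q (n - K)`; both
  -- vanish in the limit.
  have h2 : Tendsto (fun n => ∑ i ∈ range (n - K), tail f i * a (n - K - i)) ω
      (𝓝 (∑' k, q k)) := by
    have h3 := hq.hasSum.tendsto_sum_nat.comp (hshift K)
    have h4 : Tendsto (fun n => tail f (n - K) * a 0) ω (𝓝 0) := by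
      have := ((summable_tail hf0 hf hfm).tendsto_atTop_zero.comp (hshift K)).mul_const (a 0)
      simpa using this
    have h5 : Tendsto (fun n => q (n - K)) ω (𝓝 0) := hq.tendsto_atTop_zero.comp (hshift K)
    have h6 := (h3.add h5).sub h4
    rw [add_zero, sub_zero] at h6
    refine h6.congr fun n => ?_
    have := sum_tail_mul ha (n - K)
    rw [sum_range_succ, sum_range_succ, Nat.sub_self] at this
    simp only [Function.comp]
    linarith
  have h3 := tendsto_nhds_unique h1 h2
  simp only [hvK] at h3
  rw [← h3, tsum_mul_right, mul_comm]

/-- The discrete renewal theorem (Erdős, Feller and Pollard) for aperiodic waiting times with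
finite expectation; `f k` is the probability of the waiting time `k + 1`. -/
theorem tendsto_of_renewal_eq (hf0 : ∀ k, 0 ≤ f k) (hf : HasSum f 1)
    (hfm : Summable fun k : ℕ => ((k : ℝ) + 1) * f k) {K : ℕ}
    (hK : ∀ n ≥ K, n ∈ AddSubmonoid.closure {m | ∃ j, m = j + 1 ∧ 0 < f j})
    {B : ℝ} (hB : ∀ n, |a n| ≤ B) (hq : Summable q)
    (ha : ∀ n, a n = q n + ∑ k ∈ range n, f k * a (n - 1 - k)) :
    Tendsto a atTop (𝓝 ((∑' k, q k) / ∑' k, tail f k)) := by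
  have hM : 0 < ∑' k, tail f k :=
    (summable_tail hf0 hf hfm).tsum_pos (tail_nonneg hf0 hf) 0 (by simp [tail])
  have hcomp : IsCompact {l | MapClusterPt l atTop a} := by
    refine (isCompact_Icc (a := -B) (b := B)).of_isClosed_subset isClosed_setOfPred_clusterPt ?_
    intro l hl
    exact isClosed_Icc.mem_of_mapClusterPt hl
      (Eventually.of_forall fun n => abs_le.1 (hB n))
  have hne : {l | MapClusterPt l atTop a}.Nonempty := by
    obtain ⟨l, -, hl⟩ := (isCompact_Icc (a := -B) (b := B)).exists_mapClusterPt
      (f := atTop) (u := a) (by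
        exact tendsto_principal.2 (Eventually.of_forall fun n => abs_le.1 (hB n)))
    exact ⟨l, hl⟩
  obtain ⟨x, hx, hxmax⟩ := hcomp.exists_isGreatest hne
  obtain ⟨y, hy, hymin⟩ := hcomp.exists_isLeast hne
  have h1 := greatest_cluster_point hf0 hf hfm hK hB hq ha hx fun l' hl' => hxmax hl'
  have neg : ∀ {l : ℝ} {b : ℕ → ℝ}, MapClusterPt l atTop b →
      MapClusterPt (-l) atTop fun n => -b n := fun h => h.continuousAt_comp continuousAt_neg
  -- The least cluster point of `a` is, up to sign, the greatest of `-a`, which solves the renewal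
  -- equation with `-q`.
  have h2 := greatest_cluster_point (a := fun n => -a n) (q := fun n => -q n) hf0 hf hfm hK
    (B := B) (fun n => by simpa using hB n) hq.neg
    (fun n => by rw [ha n]; simp [sum_neg_distrib]; ring)
    (neg hy) fun l' hl' => by
      have h3 := neg hl'
      simp only [neg_neg] at h3
      have := hymin h3
      linarith
  rw [tsum_neg] at h2
  have hx' : x = (∑' k, q k) / ∑' k, tail f k := by rw [eq_div_iff hM.ne', h1]
  have hy' : y = (∑' k, q k) / ∑' k, tail f k := by rw [eq_div_iff hM.ne']; linarith
  refine (isCompact_Icc (a := -B) (b := B)).tendsto_nhds_of_unique_mapClusterPt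
    (Eventually.of_forall fun n => abs_le.1 (hB n)) fun l _ hl => ?_
  exact le_antisymm (hx' ▸ hxmax hl) (hy' ▸ hymin hl)

end Renewal

/-! ### Averaging operators, killed walks and first entrance -/

namespace RandomWalk

open Finset

variable {S ι : Type*} [Fintype ι] {w : S → ι → ℝ} {t : S → ι → S}

/-- The expectation of `g` after one step of the walk that moves from `c` to `t c b` with
probability `w c b`. -/
noncomputable def avg (w : S → ι → ℝ) (t : S → ι → S) (g : S → ℝ) (c : S) : ℝ := ∑ b, w c b * g (t c b)

open Classical in
/-- One step of the walk that is killed when it enters `d`. -/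
noncomputable def tabooAvg (w : S → ι → ℝ) (t : S → ι → S) (d : S) (g : S → ℝ) : S → ℝ :=
  avg w t fun e => if e = d then 0 else g e

open Classical in
/-- The indicator function of `d`. -/
noncomputable def delta (d : S) : S → ℝ := fun e => if e = d then 1 else 0

/-- The probability that the walk first enters `d` (after time `0`) at time `k + 1`. -/
noncomputable def firstPassage (w : S → ι → ℝ) (t : S → ι → S) (d : S) (k : ℕ) : S → ℝ :=
  (tabooAvg w t d)^[k] (avg w t (delta d))

/-- The weights of the walk are probabilities. -/
structure IsStochastic (w : S → ι → ℝ) : Prop where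
  nonneg : ∀ c b, 0 ≤ w c b
  sum_eq_one : ∀ c, ∑ b, w c b = 1

theorem avg_mono (hw : IsStochastic w) {g h : S → ℝ} (hgh : ∀ e, g e ≤ h e) (c : S) :
    avg w t g c ≤ avg w t h c :=
  sum_le_sum fun b _ => mul_le_mul_of_nonneg_left (hgh _) (hw.nonneg c b)

theorem avg_const (hw : IsStochastic w) (r : ℝ) (c : S) : avg w t (fun _ => r) c = r := by
  simp [avg, ← sum_mul, hw.sum_eq_one]

theorem avg_add (g h : S → ℝ) (c : S) :
    avg w t (fun e => g e + h e) c = avg w t g c + avg w t h c := by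
  simp [avg, mul_add, sum_add_distrib]

theorem avg_sum {κ : Type*} (s : Finset κ) (g : κ → S → ℝ) (c : S) :
    avg w t (fun e => ∑ k ∈ s, g k e) c = ∑ k ∈ s, avg w t (g k) c := by
  simp only [avg, mul_sum]
  exact sum_comm

theorem avg_mul_const (g : S → ℝ) (r : ℝ) (c : S) :
    avg w t (fun e => g e * r) c = avg w t g c * r := by
  simp [avg, sum_mul, mul_assoc]

theorem tabooAvg_mono (hw : IsStochastic w) (d : S) {g h : S → ℝ} (hgh : ∀ e, g e ≤ h e) (c : S) :
    tabooAvg w t d g c ≤ tabooAvg w t d h c :=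
  avg_mono hw (fun e => by split_ifs <;> simp [hgh]) c

theorem tabooAvg_mul_const (d : S) (g : S → ℝ) (r : ℝ) (c : S) :
    tabooAvg w t d (fun e => g e * r) c = tabooAvg w t d g c * r := by
  rw [tabooAvg, tabooAvg, ← avg_mul_const]
  congr 1
  funext e
  split_ifs <;> simp

theorem tabooAvg_add (d : S) (g h : S → ℝ) (c : S) :
    tabooAvg w t d (fun e => g e + h e) c = tabooAvg w t d g c + tabooAvg w t d h c := by
  simp only [tabooAvg]
  rw [← avg_add]
  congr 1
  funext e
  split_ifs <;> simp

theorem tabooAvg_sum {κ : Type*} (s : Finset κ) (d : S) (g : κ → S → ℝ) (c : S) :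
    tabooAvg w t d (fun e => ∑ k ∈ s, g k e) c = ∑ k ∈ s, tabooAvg w t d (g k) c := by
  simp only [tabooAvg]
  rw [← avg_sum]
  congr 1
  funext e
  split_ifs <;> simp

theorem tabooAvg_iterate_mono (hw : IsStochastic w) (d : S) (k : ℕ) {g h : S → ℝ}
    (hgh : ∀ e, g e ≤ h e) (c : S) :
    (tabooAvg w t d)^[k] g c ≤ (tabooAvg w t d)^[k] h c := by
  induction k generalizing c with
  | zero => exact hgh c
  | succ k ih =>
    simp only [Function.iterate_succ_apply']
    exact tabooAvg_mono hw d ih c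

theorem tabooAvg_iterate_mul_const (d : S) (k : ℕ) (g : S → ℝ) (r : ℝ) (c : S) :
    (tabooAvg w t d)^[k] (fun e => g e * r) c = (tabooAvg w t d)^[k] g c * r := by
  induction k generalizing c with
  | zero => rfl
  | succ k ih =>
    simp only [Function.iterate_succ_apply']
    rw [funext ih, tabooAvg_mul_const]

theorem abs_tabooAvg_iterate_le (hw : IsStochastic w) (d : S) {g : S → ℝ} {B : ℝ}
    (hg : ∀ e, |g e| ≤ B) (k : ℕ) (c : S) :
    |(tabooAvg w t d)^[k] g c| ≤ (tabooAvg w t d)^[k] (fun _ => 1) c * B := by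
  have h1 : ∀ r : ℝ, (tabooAvg w t d)^[k] (fun _ => r) c
      = (tabooAvg w t d)^[k] (fun _ => 1) c * r := fun r => by
    rw [← tabooAvg_iterate_mul_const]; simp
  rw [abs_le]
  constructor
  · rw [← mul_neg, ← h1]
    exact tabooAvg_iterate_mono hw d k (fun e => (abs_le.1 (hg e)).1) c
  · rw [← h1]
    exact tabooAvg_iterate_mono hw d k (fun e => (abs_le.1 (hg e)).2) c

theorem avg_iterate_const (hw : IsStochastic w) (n : ℕ) (r : ℝ) (c : S) :
    (avg w t)^[n] (fun _ => r) c = r := by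
  induction n with
  | zero => rfl
  | succ n ih =>
    rw [Function.iterate_succ_apply]
    have : avg w t (fun _ => r) = fun _ => r := funext fun c => avg_const hw r c
    rw [this, ih]

theorem avg_iterate_mono (hw : IsStochastic w) (n : ℕ) {g h : S → ℝ} (hgh : ∀ e, g e ≤ h e)
    (c : S) : (avg w t)^[n] g c ≤ (avg w t)^[n] h c := by
  induction n generalizing c with
  | zero => exact hgh c
  | succ k ih =>
    simp only [Function.iterate_succ_apply']
    exact avg_mono hw ih c

theorem abs_avg_iterate_le (hw : IsStochastic w) {g : S → ℝ} {B : ℝ} (hg : ∀ e, |g e| ≤ B)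
    (n : ℕ) (c : S) : |(avg w t)^[n] g c| ≤ B := by
  rw [abs_le]
  constructor
  · rw [← avg_iterate_const (t := t) hw n (-B) c]
    exact avg_iterate_mono hw n (fun e => (abs_le.1 (hg e)).1) c
  · rw [← avg_iterate_const (t := t) hw n B c]
    exact avg_iterate_mono hw n (fun e => (abs_le.1 (hg e)).2) c

theorem avg_eq_add_tabooAvg (d : S) (g : S → ℝ) (c : S) :
    avg w t g c = avg w t (delta d) c * g d + tabooAvg w t d g c := by
  rw [tabooAvg, ← avg_mul_const, ← avg_add]
  congr 1
  funext e
  by_cases h : e = d <;> simp [delta, h]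

/-- Decomposition of the walk at its first entrance into `d`. -/
theorem avg_iterate_succ_eq (d : S) (g : S → ℝ) (n : ℕ) (c : S) :
    (avg w t)^[n + 1] g c =
      ∑ k ∈ range (n + 1), firstPassage w t d k c * (avg w t)^[n - k] g d
        + (tabooAvg w t d)^[n + 1] g c := by
  induction n generalizing c with
  | zero => simpa [firstPassage] using avg_eq_add_tabooAvg d g c
  | succ n ih =>
    rw [Function.iterate_succ_apply', avg_eq_add_tabooAvg d, sum_range_succ']
    have h1 : tabooAvg w t d ((avg w t)^[n + 1] g) c
        = ∑ k ∈ range (n + 1), firstPassage w t d (k + 1) c * (avg w t)^[n - k] g d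
          + (tabooAvg w t d)^[n + 1 + 1] g c := by
      rw [funext ih, tabooAvg_add, tabooAvg_sum, ← Function.iterate_succ_apply' (f := tabooAvg w t d)]
      congr 1
      refine sum_congr rfl fun k _ => ?_
      rw [tabooAvg_mul_const, firstPassage, firstPassage, Function.iterate_succ_apply']
    rw [h1]
    simp only [Nat.add_sub_add_right, Nat.sub_zero]
    simp only [firstPassage, Function.iterate_zero, id]
    ring

end RandomWalk

/-! ### Convergence to the excursion measure -/

namespace RandomWalk

open Finset Renewal

variable {S ι : Type*} [Fintype ι] {w : S → ι → ℝ} {t : S → ι → S}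

theorem delta_nonneg (d e : S) : 0 ≤ delta d e := by
  unfold delta; split_ifs <;> norm_num

theorem tabooAvg_iterate_nonneg (hw : IsStochastic w) (d : S) (k : ℕ) {g : S → ℝ}
    (hg : ∀ e, 0 ≤ g e) (c : S) : 0 ≤ (tabooAvg w t d)^[k] g c := by
  have h1 : (tabooAvg w t d)^[k] (fun _ => (0 : ℝ)) c = 0 := by
    simpa using tabooAvg_iterate_mul_const (w := w) (t := t) d k (fun _ => (1 : ℝ)) 0 c
  rw [← h1]
  exact tabooAvg_iterate_mono hw d k hg c

theorem avg_iterate_nonneg (hw : IsStochastic w) (k : ℕ) {g : S → ℝ}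
    (hg : ∀ e, 0 ≤ g e) (c : S) : 0 ≤ (avg w t)^[k] g c := by
  rw [← avg_iterate_const (t := t) hw k 0 c]
  exact avg_iterate_mono hw k hg c

theorem firstPassage_nonneg (hw : IsStochastic w) (d : S) (k : ℕ) (c : S) :
    0 ≤ firstPassage w t d k c :=
  tabooAvg_iterate_nonneg hw d k (fun e => avg_iterate_nonneg hw 1 (delta_nonneg d) e) c

/-- The first-entrance decomposition applied to the constant `1`: the walk has either entered `d` by
time `n` or survived. -/
theorem tabooAvg_iterate_one (hw : IsStochastic w) (d : S) (n : ℕ) (c : S) :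
    (tabooAvg w t d)^[n] (fun _ => 1) c = tail (fun k => firstPassage w t d k c) n := by
  cases n with
  | zero => simp [tail]
  | succ n =>
    have := avg_iterate_succ_eq (w := w) (t := t) d (fun _ => 1) n c
    simp only [avg_iterate_const hw, mul_one] at this
    rw [tail]
    linarith

theorem sum_firstPassage_le_one (hw : IsStochastic w) (d : S) (n : ℕ) (c : S) :
    ∑ k ∈ range n, firstPassage w t d k c ≤ 1 := by
  have := tabooAvg_iterate_nonneg (t := t) hw d n (g := fun _ => 1) (fun _ => zero_le_one) c
  rw [tabooAvg_iterate_one hw, tail] at this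
  linarith

theorem summable_firstPassage (hw : IsStochastic w) (d c : S) :
    Summable fun k => firstPassage w t d k c :=
  summable_of_sum_range_le (fun k => firstPassage_nonneg hw d k c)
    fun n => sum_firstPassage_le_one hw d n c

theorem tsum_firstPassage_le_one (hw : IsStochastic w) (d c : S) :
    ∑' k, firstPassage w t d k c ≤ 1 :=
  Real.tsum_le_of_sum_range_le (fun k => firstPassage_nonneg hw d k c)
    fun n => sum_firstPassage_le_one hw d n c

theorem avg_iterate_eq (d : S) (g : S → ℝ) (n : ℕ) (c : S) :
    (avg w t)^[n] g c = (tabooAvg w t d)^[n] g c +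
      ∑ k ∈ range n, firstPassage w t d k c * (avg w t)^[n - 1 - k] g d := by
  cases n with
  | zero => simp
  | succ n => rw [avg_iterate_succ_eq d, add_comm]; simp

theorem tabooAvg_iterate_delta (d : S) (n : ℕ) (c : S) :
    (tabooAvg w t d)^[n + 1] (delta d) c = 0 := by
  have h : tabooAvg w t d (delta d) = fun _ => 0 := by
    funext e
    refine sum_eq_zero fun b _ => ?_
    by_cases h : t e b = d <;> simp [delta, h]
  rw [Function.iterate_succ_apply, h]
  simpa using tabooAvg_iterate_mul_const (w := w) (t := t) d n (fun _ => (1 : ℝ)) 0 c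

/-- A return splits into successive first returns. This carries aperiodicity from return times to
the waiting times of the renewal equation. -/
theorem mem_closure_of_pos (hw : IsStochastic w) (d : S) (n : ℕ)
    (hn : 0 < (avg w t)^[n] (delta d) d) :
    n ∈ AddSubmonoid.closure {m | ∃ j, m = j + 1 ∧ 0 < firstPassage w t d j d} := by
  induction n using Nat.strong_induction_on with
  | _ n ih =>
    cases n with
    | zero => exact zero_mem _
    | succ n =>
      rw [avg_iterate_succ_eq d, tabooAvg_iterate_delta, add_zero] at hn
      obtain ⟨k, hk, hpos⟩ := exists_lt_of_sum_lt (s := range (n + 1)) (f := fun _ => (0 : ℝ))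
        (by simpa using hn)
      have hk' := mem_range.1 hk
      have h1 := firstPassage_nonneg (t := t) hw d k d
      have h2 := avg_iterate_nonneg (t := t) hw (n - k) (delta_nonneg d) d
      have h3 : 0 < firstPassage w t d k d := lt_of_le_of_ne h1 fun h => by simp [← h] at hpos
      have h4 : 0 < (avg w t)^[n - k] (delta d) d := lt_of_le_of_ne h2 fun h => by
        simp [← h] at hpos
      have h5 : n + 1 = (k + 1) + (n - k) := by omega
      rw [h5]
      exact add_mem (AddSubmonoid.subset_closure ⟨k, rfl, h3⟩) (ih _ (by omega) h4)

/-- The state `d` is aperiodic and positive recurrent. -/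
structure IsErgodicState (w : S → ι → ℝ) (t : S → ι → S) (d : S) : Prop where
  aperiodic : Nat.setGcd {n : ℕ | 0 < n ∧ 0 < (avg w t)^[n] (delta d) d} = 1
  recurrent : HasSum (fun k => firstPassage w t d k d) 1
  finite_mean : Summable fun k : ℕ => ((k : ℝ) + 1) * firstPassage w t d k d

theorem IsErgodicState.summable_tail (hw : IsStochastic w) {d : S} (hd : IsErgodicState w t d) :
    Summable (tail fun k => firstPassage w t d k d) :=
  Renewal.summable_tail (fun k => firstPassage_nonneg hw d k d) hd.recurrent hd.finite_mean

/-- The limit of the expectations of `g`, expressed by an excursion from `d`. -/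
noncomputable def excursionMean (w : S → ι → ℝ) (t : S → ι → S) (d : S) (g : S → ℝ) : ℝ :=
  (∑' k, (tabooAvg w t d)^[k] g d) / ∑' k, tail (fun k => firstPassage w t d k d) k

theorem tendsto_avg_iterate_self (hw : IsStochastic w) {d : S} (hd : IsErgodicState w t d)
    {g : S → ℝ} {B : ℝ} (hg : ∀ e, |g e| ≤ B) :
    Tendsto (fun n => (avg w t)^[n] g d) atTop (𝓝 (excursionMean w t d g)) := by
  -- The additive semigroup generated by the return times contains all large multiples of their gcd,
  -- which is `1`.
  obtain ⟨K, hK⟩ := Nat.exists_mem_closure_of_ge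
    {n : ℕ | 0 < n ∧ 0 < (avg w t)^[n] (delta d) d}
  refine tendsto_of_renewal_eq (K := K) (B := B) (fun k => firstPassage_nonneg hw d k d)
    hd.recurrent hd.finite_mean (fun n hn => ?_) (fun n => abs_avg_iterate_le hw hg n d) ?_
    fun n => avg_iterate_eq d g n d
  · have h1 := hK n hn (by rw [hd.aperiodic]; exact one_dvd _)
    exact (AddSubmonoid.closure_le.2 fun m hm => mem_closure_of_pos hw d m hm.2) h1
  · refine Summable.of_norm_bounded ((hd.summable_tail hw).mul_right B) fun n => ?_
    rw [← tabooAvg_iterate_one hw]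
    exact abs_tabooAvg_iterate_le hw d hg n d

/-- The hitting probability `H` of `d` is harmonic, even at `d` because recurrence gives `H d = 1`.
So `1 - H` is nonnegative, harmonic and zero at `d`, and must vanish at every state reachable from
`d`. -/
theorem tsum_firstPassage_eq_one (hw : IsStochastic w) {d : S} (hd : IsErgodicState w t d)
    {c : S} {j : ℕ} (hj : 0 < (avg w t)^[j] (delta c) d) :
    ∑' k, firstPassage w t d k c = 1 := by
  set H : S → ℝ := fun c => ∑' k, firstPassage w t d k c with hH
  have hHd : H d = 1 := hd.recurrent.tsum_eq
  have hharm : avg w t H = H := by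
    funext e
    rw [avg_eq_add_tabooAvg d, hHd, mul_one]
    have h1 := (summable_firstPassage (t := t) hw d e).tsum_eq_zero_add
    have h2 : HasSum (fun k => firstPassage w t d (k + 1) e) (tabooAvg w t d H e) := by
      have h3 : ∀ k, firstPassage w t d (k + 1) = tabooAvg w t d (firstPassage w t d k) :=
        fun k => Function.iterate_succ_apply' _ _ _
      simp only [h3]
      refine hasSum_sum fun b _ => HasSum.mul_left _ ?_
      beta_reduce
      split_ifs
      · exact hasSum_zero
      · exact (summable_firstPassage hw d _).hasSum
    rw [h2.tsum_eq] at h1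
    exact h1.symm
  have hG : avg w t (fun e => 1 + H e * (-1)) = fun e => 1 + H e * (-1) := by
    funext e
    rw [avg_add, avg_mul_const, avg_const hw, hharm]
  have h1 : (avg w t)^[j] (fun e => 1 + H e * (-1)) d = 0 := by
    rw [Function.iterate_fixed hG]
    simp [hHd]
  have h2 : (avg w t)^[j] (fun e => delta c e * (1 - H c)) d ≤ 0 := by
    rw [← h1]
    refine avg_iterate_mono hw j (fun e => ?_) d
    by_cases he : e = c
    · simp [delta, he]
    · have : H e ≤ 1 := tsum_firstPassage_le_one hw d e
      simp [delta, he, this]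
  have h3 : ∀ (r : ℝ) (g : S → ℝ), (avg w t)^[j] (fun e => g e * r) d
      = (avg w t)^[j] g d * r := by
    intro r g
    clear hj h1 h2
    generalize d = d'
    induction j generalizing d' with
    | zero => rfl
    | succ j ih =>
      simp only [Function.iterate_succ_apply']
      rw [funext ih, avg_mul_const]
  rw [h3] at h2
  have h4 : H c ≤ 1 := tsum_firstPassage_le_one hw d c
  have h5 : 1 - H c ≤ 0 := nonpos_of_mul_nonpos_right h2 hj
  exact le_antisymm h4 (by linarith)

/-- From `c` the walk enters `d` almost surely. Conditioning on the entrance time reduces to a start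
at `d`; the part that has not yet entered is at most `B` times a vanishing tail. -/
theorem tendsto_avg_iterate (hw : IsStochastic w) {d : S} (hd : IsErgodicState w t d)
    {c : S} {j : ℕ} (hj : 0 < (avg w t)^[j] (delta c) d)
    {g : S → ℝ} {B : ℝ} (hg : ∀ e, |g e| ≤ B) :
    Tendsto (fun n => (avg w t)^[n] g c) atTop (𝓝 (excursionMean w t d g)) := by
  rw [← tendsto_add_atTop_iff_nat 1]
  have hsum := summable_firstPassage (t := t) hw d c
  have hone := tsum_firstPassage_eq_one hw hd hj
  have h1 := (tendsto_sum_range_mul (a := fun n => (avg w t)^[n] g d) hsum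
    (fun k => firstPassage_nonneg hw d k c)
    (fun n => abs_avg_iterate_le hw hg n d) le_rfl 1 0 fun k =>
      (tendsto_avg_iterate_self hw hd hg).comp (tendsto_sub_atTop_nat k)).comp
      (tendsto_add_atTop_nat 1)
  rw [tsum_mul_right, hone, one_mul] at h1
  have h2 : Tendsto (fun n => (tabooAvg w t d)^[n + 1] g c) atTop (𝓝 0) := by
    have h3 : Tendsto (fun n => tail (fun k => firstPassage w t d k c) (n + 1) * B) atTop (𝓝 0) := by
      have h4 := ((hsum.hasSum.tendsto_sum_nat.comp (tendsto_add_atTop_nat 1)).const_sub 1).mul_const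
        B
      rw [hone, sub_self, zero_mul] at h4
      exact h4
    refine squeeze_zero_norm (fun n => ?_) h3
    rw [← tabooAvg_iterate_one hw]
    exact abs_tabooAvg_iterate_le hw d hg _ c
  have h5 := h1.add h2
  rw [add_zero] at h5
  refine h5.congr fun n => ?_
  rw [avg_iterate_succ_eq d]
  simp [Function.comp]

theorem hasSum_tabooAvg_iterate (d : S) (g : S → ℝ) (k : ℕ) (c : S) :
    HasSum (fun e => (tabooAvg w t d)^[k] (delta e) c * g e) ((tabooAvg w t d)^[k] g c) := by
  induction k generalizing c with
  | zero =>
    have h := hasSum_single (f := fun e => delta e c * g e) c fun e he => by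
      simp [delta, Ne.symm he]
    simpa [delta] using h
  | succ k ih =>
    simp only [Function.iterate_succ_apply', tabooAvg, avg, sum_mul, mul_assoc]
    refine hasSum_sum fun b _ => HasSum.mul_left _ ?_
    split_ifs
    · simp
    · exact ih _

/-- Fubini over times and states: summing the killed kernel over states gives the tails, which are
summable in time by the finite mean return time. Hence no mass escapes in the limit. -/
theorem hasSum_excursionMean (hw : IsStochastic w) {d : S} (hd : IsErgodicState w t d)
    {g : S → ℝ} {B : ℝ} (hg : ∀ e, |g e| ≤ B) :
    HasSum (fun e => excursionMean w t d (delta e) * g e) (excursionMean w t d g) := by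
  have hG0 : ∀ k e, 0 ≤ (tabooAvg w t d)^[k] (delta e) d := fun k e =>
    tabooAvg_iterate_nonneg hw d k (delta_nonneg e) d
  have hG1 : ∀ k, HasSum (fun e => (tabooAvg w t d)^[k] (delta e) d)
      (tail (fun k => firstPassage w t d k d) k) := fun k => by
    rw [← tabooAvg_iterate_one hw]
    simpa using hasSum_tabooAvg_iterate (w := w) (t := t) d (fun _ => 1) k d
  have hG : Summable fun p : ℕ × S => (tabooAvg w t d)^[p.1] (delta p.2) d := by
    refine (summable_prod_of_nonneg fun p => hG0 _ _).2 ⟨fun k => (hG1 k).summable, ?_⟩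
    simpa only [(hG1 _).tsum_eq] using hd.summable_tail hw
  have hF : Summable fun p : ℕ × S => (tabooAvg w t d)^[p.1] (delta p.2) d * g p.2 := by
    refine Summable.of_norm_bounded (hG.mul_right B) fun p => ?_
    rw [Real.norm_eq_abs, abs_mul, abs_of_nonneg (hG0 _ _)]
    exact mul_le_mul_of_nonneg_left (hg _) (hG0 _ _)
  have h1 := hF.hasSum.prod_fiberwise fun k => hasSum_tabooAvg_iterate d g k d
  have h2 := ((Equiv.prodComm S ℕ).hasSum_iff.2 hF.hasSum).prod_fiberwise fun e =>
    ((((Equiv.prodComm S ℕ).summable_iff.2 hG).prod_factor e).hasSum.mul_right (g e))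
  rw [← h1.tsum_eq] at h2
  have h3 := h2.div_const (∑' k, tail (fun k => firstPassage w t d k d) k)
  simp only [excursionMean, div_mul_eq_mul_div]
  exact h3

end RandomWalk

/-! ### The walk on the tree as a Markov chain on computers -/

namespace StationaryAlgProb

open Finset RandomWalk

variable {Φ : Set Computer}

theorem Computer.after_nil (C : Computer) : C.after [] = C := rfl

theorem Computer.after_append (C : Computer) (x y : Str) :
    C.after (x ++ y) = (C.after x).after y := by
  ext1
  funext s
  simp [Computer.after]

theorem Computer.after_cons (C : Computer) (b : Bool) (y : Str) :
    C.after (b :: y) = (C.after [b]).after y := C.after_append [b] y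

theorem cons_mem_tree {C : Computer} {b : Bool} {y : Str} :
    b :: y ∈ tree Φ C ↔ y ∈ tree Φ (C.after [b]) := by
  simp only [tree, Set.mem_ofPred_eq, C.after_cons b y]

theorem singleton_mem_tree {C : Computer} {b : Bool} : [b] ∈ tree Φ C ↔ C.after [b] ∈ Φ :=
  Iff.rfl

-- Path probabilities are defined by appending bits at the end; the Markov property needs them split
-- at the first bit, beyond which the tree is that of `C.after [b]`.
open Classical in
theorem pathProb_cons (C : Computer) (b : Bool) (y : Str) :
    pathProb (tree Φ C) (b :: y) =
      (if C.after [!b] ∈ Φ then 1 / 2 else 1) * pathProb (tree Φ (C.after [b])) y := by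
  induction y using List.reverseRecOn with
  | nil =>
    have := pathProb_concat (tree Φ C) [] b
    simp only [List.nil_append, pathProb_nil, singleton_mem_tree] at this
    rw [this, pathProb_nil, mul_one]
  | append_singleton y c ih =>
    have := pathProb_concat (tree Φ C) (b :: y) c
    rw [List.cons_append, List.cons_append, cons_mem_tree, ih] at this
    rw [this, pathProb_concat]
    split_ifs <;> ring

open Classical in
/-- The probability of the bit `b` in the first step of the random walk on the tree of `C`. -/
noncomputable def bitProb (Φ : Set Computer) (C : Φ) (b : Bool) : ℝ :=
  if C.1.after [b] ∈ Φ then (if C.1.after [!b] ∈ Φ then 1 / 2 else 1) else 0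

open Classical in
/-- The computer reached from `C` by the bit `b`; a bit that leaves `Φ` has probability `0`, and
the value for it is irrelevant. -/
noncomputable def next (Φ : Set Computer) (C : Φ) (b : Bool) : Φ :=
  if h : C.1.after [b] ∈ Φ then ⟨C.1.after [b], h⟩ else C

theorem isStochastic_bitProb (hΦ : IsBranching Φ) : IsStochastic (bitProb Φ) where
  nonneg C b := by unfold bitProb; split_ifs <;> norm_num
  sum_eq_one C := by
    obtain ⟨x, hx, hmem⟩ := hΦ.exists_mem C.1 C.2
    have : ∃ b, C.1.after [b] ∈ Φ := by
      cases x with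
      | nil => exact absurd rfl hx
      | cons b y => exact ⟨b, hΦ.prefix_mem C.1 C.2 [b] y hmem⟩
    simp only [bitProb, Fintype.sum_bool, Bool.not_true, Bool.not_false]
    obtain ⟨b, hb⟩ := this
    by_cases h0 : C.1.after [true] ∈ Φ <;> by_cases h1 : C.1.after [false] ∈ Φ
    · norm_num [h0, h1]
    · norm_num [h0, h1]
    · norm_num [h0, h1]
    · cases b <;> contradiction

open Classical in
/-- The expectation of `g x`, where `x` is the path of length `n` of the walk on the tree of `C`. -/
noncomputable def pathMean (Φ : Set Computer) (n : ℕ) (C : Computer) (g : Str → ℝ) : ℝ :=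
  ∑ x : List.Vector Bool n,
    if x.toList ∈ tree Φ C then pathProb (tree Φ C) x.toList * g x.toList else 0

theorem pathMean_zero {C : Computer} (hC : C ∈ Φ) (g : Str → ℝ) : pathMean Φ 0 C g = g [] := by
  have h : [] ∈ tree Φ C := hC
  simp [pathMean, h, pathProb_nil]

theorem sum_vector_succ {n : ℕ} (F : Str → ℝ) :
    ∑ x : List.Vector Bool (n + 1), F x.toList
      = ∑ b, ∑ y : List.Vector Bool n, F (b :: y.toList) := by
  rw [← Fintype.sum_prod_type' (f := fun b (y : List.Vector Bool n) => F (b :: y.toList))]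
  refine (Fintype.sum_equiv (⟨fun p => p.1 ::ᵥ p.2, fun v => (v.head, v.tail), fun p => by simp,
    fun v => by simp⟩ : Bool × List.Vector Bool n ≃ List.Vector Bool (n + 1)) _ _ fun p => ?_).symm
  simp

theorem pathMean_succ (hΦ : IsBranching Φ) (n : ℕ) (C : Φ) (g : Str → ℝ) :
    pathMean Φ (n + 1) C g =
      ∑ b, bitProb Φ C b * pathMean Φ n (next Φ C b) fun y => g (b :: y) := by
  classical
  rw [pathMean, sum_vector_succ
    (fun x => if x ∈ tree Φ C then pathProb (tree Φ C) x * g x else 0)]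
  refine sum_congr rfl fun b _ => ?_
  by_cases hb : C.1.after [b] ∈ Φ
  · simp only [bitProb, next, hb, if_true, dif_pos, pathMean, mul_sum, cons_mem_tree,
      pathProb_cons]
    refine sum_congr rfl fun y _ => ?_
    split_ifs <;> ring
  · have h : ∀ y, b :: y ∉ tree Φ C := fun y hy => hb (hΦ.prefix_mem C.1 C.2 [b] y hy)
    simp [bitProb, hb, h]

theorem pathMean_congr {n : ℕ} {C : Computer} {g h : Str → ℝ}
    (hgh : ∀ x : Str, x.length = n → g x = h x) : pathMean Φ n C g = pathMean Φ n C h :=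
  sum_congr rfl fun x _ => by rw [hgh _ x.toList_length]

theorem next_of_mem {C : Φ} {b : Bool} (hb : C.1.after [b] ∈ Φ) :
    next Φ C b = ⟨C.1.after [b], hb⟩ := dif_pos hb

/-- The family `G` expresses that, after the first bit, the functional depends only on the computer
reached and the remaining bits. -/
theorem pathMean_succ_eq_avg (hΦ : IsBranching Φ) {n : ℕ} {C : Φ} {g : Str → ℝ}
    {G : Computer → Str → ℝ}
    (hg : ∀ b y, y.length = n → g (b :: y) = G (C.1.after [b]) y) :
    pathMean Φ (n + 1) C g =
      avg (bitProb Φ) (next Φ) (fun U => pathMean Φ n U (G U)) C := by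
  rw [pathMean_succ hΦ]
  refine sum_congr rfl fun b _ => ?_
  by_cases hb : C.1.after [b] ∈ Φ
  · rw [next_of_mem hb, pathMean_congr (hg b)]
  · simp [bitProb, hb]

/-- The walk on the tree induces the Markov process on the computers. -/
theorem pathMean_add (hΦ : IsBranching Φ) {n : ℕ} {G : Computer → Str → ℝ}
    (hG : ∀ C b y, n ≤ y.length → G C (b :: y) = G (C.after [b]) y) (m : ℕ) (C : Φ) :
    pathMean Φ (m + n) C (G C) =
      (avg (bitProb Φ) (next Φ))^[m] (fun U => pathMean Φ n U (G U)) C := by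
  induction m generalizing C with
  | zero => rw [zero_add]; rfl
  | succ m ih =>
    rw [add_right_comm, pathMean_succ_eq_avg hΦ (fun b y hy => hG C b y (by omega)),
      Function.iterate_succ_apply']
    congr 1
    exact funext ih

theorem pathMean_const (hΦ : IsBranching Φ) (n : ℕ) (C : Φ) (r : ℝ) :
    pathMean Φ n C (fun _ => r) = r := by
  have h := pathMean_add hΦ (n := 0) (G := fun _ _ => r) (fun _ _ _ _ => rfl) n C
  rw [add_zero] at h
  rw [h]
  have : (fun U : Φ => pathMean Φ 0 U fun _ => r) = fun _ => r :=
    funext fun U => pathMean_zero U.2 _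
  rw [this, avg_iterate_const (isStochastic_bitProb hΦ)]

theorem pathProb_nonneg (T : Set Str) (x : Str) : 0 ≤ pathProb T x := by
  induction x using List.reverseRecOn with
  | nil => simp [pathProb_nil]
  | append_singleton x b ih =>
    rw [pathProb_concat]
    split_ifs
    · exact div_nonneg ih (by norm_num)
    · exact ih

theorem pathMean_mono {n : ℕ} {C : Computer} {g h : Str → ℝ} (hgh : ∀ x, g x ≤ h x) :
    pathMean Φ n C g ≤ pathMean Φ n C h := by
  refine sum_le_sum fun x _ => ?_
  split_ifs
  · exact mul_le_mul_of_nonneg_left (hgh _) (pathProb_nonneg _ _)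
  · exact le_rfl

theorem abs_pathMean_le (hΦ : IsBranching Φ) (n : ℕ) (C : Φ) {g : Str → ℝ} {B : ℝ}
    (hg : ∀ x, |g x| ≤ B) : |pathMean Φ n C g| ≤ B := by
  rw [abs_le]
  constructor
  · rw [← pathMean_const hΦ n C (-B)]
    exact pathMean_mono fun x => (abs_le.1 (hg x)).1
  · rw [← pathMean_const hΦ n C B]
    exact pathMean_mono fun x => (abs_le.1 (hg x)).2

theorem pathMean_sum {κ : Type*} (s : Finset κ) (n : ℕ) (C : Computer) (g : κ → Str → ℝ) :
    ∑ k ∈ s, pathMean Φ n C (g k) = pathMean Φ n C fun x => ∑ k ∈ s, g k x := by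
  simp only [pathMean]
  rw [sum_comm]
  refine sum_congr rfl fun x _ => ?_
  split_ifs
  · rw [mul_sum]
  · simp

open Classical in
theorem stepProb_eq_pathMean (n : ℕ) (C : Computer) {D : Computer} (hD : D ∈ Φ) :
    stepProb Φ n C D = pathMean Φ n C fun x => if C.after x = D then 1 else 0 := by
  rw [stepProb, pathMean, sum_filter]
  refine sum_congr rfl fun x _ => ?_
  by_cases h : C.after x.toList = D
  · have h' : x.toList ∈ tree Φ C := by rw [tree, Set.mem_ofPred_eq, h]; exact hD
    simp [h, h']
  · simp [h]

open Classical in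
theorem stepStringProb_eq_pathMean (n : ℕ) (C : Computer) (s : Part Str) :
    stepStringProb Φ n C s = pathMean Φ n C fun x => if C x = s then 1 else 0 := by
  rw [stepStringProb, pathMean, sum_filter]
  refine sum_congr rfl fun x _ => ?_
  by_cases h : x.toList ∈ tree Φ C <;> simp [h]

theorem stepProb_eq_avg_iterate (hΦ : IsBranching Φ) (n : ℕ) (C D : Φ) :
    stepProb Φ n C D = (avg (bitProb Φ) (next Φ))^[n] (delta D) C := by
  classical
  have h := pathMean_add hΦ (n := 0) (G := fun C x => if C.after x = D then 1 else 0)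
    (fun C b y _ => by rw [C.after_cons]) n C
  rw [add_zero] at h
  rw [stepProb_eq_pathMean n C.1 D.2, h]
  refine congrFun (congrArg _ (funext fun U => ?_)) C
  rw [pathMean_zero U.2, Computer.after_nil, delta]
  simp only [Subtype.ext_iff]

open Classical in
theorem pathMean_firstPassage (hΦ : IsBranching Φ) (D : Φ) (k : ℕ) (C : Φ) :
    pathMean Φ (k + 1) C (fun x =>
      if C.1.after x = D ∧ ∀ i, 0 < i → i < k + 1 → C.1.after (x.take i) ≠ D then 1 else 0)
      = firstPassage (bitProb Φ) (next Φ) D k C := by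
  induction k generalizing C with
  | zero =>
    have h := stepProb_eq_avg_iterate hΦ 1 C D
    rw [stepProb_eq_pathMean 1 C.1 D.2] at h
    rw [firstPassage, Function.iterate_zero, id, ← Function.iterate_one (avg _ _), ← h]
    refine pathMean_congr fun x _ => ?_
    exact if_congr (and_iff_left fun i h1 h2 => by omega) rfl rfl
  | succ k ih =>
    -- Reaching `D` with the first bit already rules out a later first entrance, so `G` is zero
    -- there; this is the killing in `tabooAvg`.
    rw [pathMean_succ_eq_avg hΦ (G := fun U y => if U = D then 0 else
      if U.after y = D ∧ ∀ i, 0 < i → i < k + 1 → U.after (y.take i) ≠ D then 1 else 0)]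
    · rw [firstPassage, Function.iterate_succ_apply', tabooAvg]
      congr 1
      funext U
      by_cases h : U = D
      · have h' : U.1 = D.1 := by rw [h]
        simp only [h, if_true]
        exact pathMean_const hΦ _ D 0
      · have h' : U.1 ≠ D.1 := fun h' => h (Subtype.ext h')
        simp only [h, h', if_false]
        exact ih U
    · intro b y _
      by_cases h : C.1.after [b] = D
      · rw [if_pos h, if_neg]
        rintro ⟨-, h2⟩
        exact h2 1 one_pos (by omega) (by simpa using h)
      · rw [if_neg h]
        refine if_congr ?_ rfl rfl
        rw [C.1.after_cons]
        refine and_congr_right fun _ => ⟨fun h2 i h3 h4 => ?_, fun h2 i h3 h4 => ?_⟩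
        · have := h2 (i + 1) (by omega) (by omega)
          rwa [List.take_succ_cons, C.1.after_cons] at this
        · obtain ⟨i, rfl⟩ : ∃ j, i = j + 1 := ⟨i - 1, by omega⟩
          rw [List.take_succ_cons, C.1.after_cons]
          rcases Nat.eq_zero_or_pos i with rfl | hi
          · simpa [Computer.after_nil] using h
          · exact h2 i hi (by omega)

theorem firstReturnProb_succ (hΦ : IsBranching Φ) (k : ℕ) (C : Φ) :
    firstReturnProb Φ (k + 1) C = firstPassage (bitProb Φ) (next Φ) C k C := by
  classical
  rw [← pathMean_firstPassage hΦ, firstReturnProb, pathMean, sum_filter]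
  refine sum_congr rfl fun x _ => ?_
  by_cases h : C.1.after x.toList = C
  · have h' : x.toList ∈ tree Φ C.1 := by rw [tree, Set.mem_ofPred_eq, h]; exact C.2
    simp [h, h']
  · simp [h]

theorem IsPositiveRecurrent.isErgodicState (hrec : IsPositiveRecurrent Φ) (C : Φ) :
    IsErgodicState (bitProb Φ) (next Φ) C where
  aperiodic := by
    simpa only [stepProb_eq_avg_iterate hrec.branching _ C C] using hrec.aperiodic C.1 C.2
  recurrent := by
    have h := (hasSum_nat_add_iff' 1).2 (hrec.recurrent C.1 C.2).1
    have h0 : firstReturnProb Φ 0 C.1 = 0 := by simp [firstReturnProb]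
    simpa only [firstReturnProb_succ hrec.branching, sum_range_one, h0, sub_zero] using h
  finite_mean := by
    have h := (summable_nat_add_iff 1).2 (hrec.recurrent C.1 C.2).2
    simpa [firstReturnProb_succ hrec.branching] using h

theorem IsPositiveRecurrent.tendsto_avg_iterate (hrec : IsPositiveRecurrent Φ) (D C : Φ)
    {g : Φ → ℝ} {B : ℝ} (hg : ∀ e, |g e| ≤ B) :
    Tendsto (fun n => (avg (bitProb Φ) (next Φ))^[n] g C) atTop
      (𝓝 (excursionMean (bitProb Φ) (next Φ) D g)) := by
  -- The path required runs from the reference state `D` to the start `C`: hitting `D` almost surely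
  -- is known for states reachable from `D`.
  obtain ⟨j, -, hj⟩ := hrec.irreducible D.1 D.2 C.1 C.2
  rw [stepProb_eq_avg_iterate hrec.branching] at hj
  exact RandomWalk.tendsto_avg_iterate (isStochastic_bitProb hrec.branching)
    (hrec.isErgodicState D) hj hg

end StationaryAlgProb

/-! ### Input transformations and averaging over permutations -/

namespace StationaryAlgProb

open Finset RandomWalk

variable {Φ : Set Computer} {k n : ℕ}

theorem inputMap_append (σ : Equiv.Perm (List.Vector Bool k)) (u : Str) (v : List.Vector Bool k) :
    inputMap σ (u ++ v.toList) = u ++ (σ v).toList := by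
  have h : (u ++ v.toList).length - k = u.length := by simp
  have h2 : k ≤ (u ++ v.toList).length := by simp
  rw [inputMap, dif_pos h2]
  congr 1
  · rw [h, List.take_left']; rfl
  · congr 2
    refine Subtype.ext ?_
    simp only [h, List.drop_left]
    rfl

theorem exists_eq_append_vector {s : Str} (h : k ≤ s.length) :
    ∃ (u : Str) (v : List.Vector Bool k), s = u ++ v.toList :=
  ⟨s.take (s.length - k), ⟨s.drop (s.length - k), by rw [List.length_drop]; omega⟩,
    (List.take_append_drop _ _).symm⟩

theorem inputMap_append_left (σ : Equiv.Perm (List.Vector Bool k)) (x : Str) {s : Str}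
    (h : k ≤ s.length) : inputMap σ (x ++ s) = x ++ inputMap σ s := by
  obtain ⟨u, v, rfl⟩ := exists_eq_append_vector h
  rw [← List.append_assoc, inputMap_append, inputMap_append, List.append_assoc]

theorem inputMap_inputMap (τ σ : Equiv.Perm (List.Vector Bool k)) (s : Str) :
    inputMap τ (inputMap σ s) = inputMap (τ * σ) s := by
  by_cases h : k ≤ s.length
  · obtain ⟨u, v, rfl⟩ := exists_eq_append_vector h
    simp only [inputMap_append, Equiv.Perm.mul_apply]
  · simp [inputMap, h]

theorem inputMap_one (s : Str) : inputMap (1 : Equiv.Perm (List.Vector Bool k)) s = s := by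
  by_cases h : k ≤ s.length
  · obtain ⟨u, v, rfl⟩ := exists_eq_append_vector h
    simp only [inputMap_append, Equiv.Perm.one_apply]
  · simp [inputMap, h]

theorem inputTransform_inputTransform (σ τ : Equiv.Perm (List.Vector Bool k)) (C : Computer) :
    inputTransform σ (inputTransform τ C) = inputTransform (τ * σ) C := by
  ext1
  funext s
  simp only [inputTransform, inputMap_inputMap]

theorem inputTransform_one (C : Computer) :
    inputTransform (1 : Equiv.Perm (List.Vector Bool k)) C = C := by
  ext1
  funext s
  simp only [inputTransform, inputMap_one]

/-- Every permutation is, up to the identity of `{0,1}^0`, a product of permutations that change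
a first bit. -/
theorem ClosedUnderInputTransforms.mem (hclosed : ClosedUnderInputTransforms n Φ)
    (σ : Equiv.Perm (List.Vector Bool n)) {C : Computer} (hC : C ∈ Φ) :
    inputTransform σ C ∈ Φ := by
  by_cases hσ : ChangesFirstBit σ
  · exact hclosed n le_rfl σ hσ C hC
  cases n with
  | zero =>
    have : σ = 1 := Equiv.ext fun x => by rw [x.eq_nil, (σ List.Vector.nil).eq_nil]; rfl
    rwa [this, inputTransform_one]
  | succ n =>
    have hσ' : ∀ x, x.toList.head? = (σ x).toList.head? := by
      simpa [ChangesFirstBit] using hσ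
    set a : List.Vector Bool (n + 1) := List.Vector.replicate (n + 1) true
    set b : List.Vector Bool (n + 1) := List.Vector.replicate (n + 1) false
    have hab : a.toList.head? ≠ b.toList.head? := by
      change some true ≠ some false
      decide
    -- As `σ` preserves all first bits, both the swap and `σ` times the swap change one; composing
    -- their transformations cancels the swap.
    have h1 : ChangesFirstBit (Equiv.swap a b) := ⟨a, by rwa [Equiv.swap_apply_left]⟩
    have h2 : ChangesFirstBit (σ * Equiv.swap a b) :=
      ⟨a, by rwa [Equiv.Perm.mul_apply, Equiv.swap_apply_left, ← hσ']⟩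
    have h3 := hclosed _ le_rfl _ h1 _ (hclosed _ le_rfl _ h2 C hC)
    rwa [inputTransform_inputTransform, mul_assoc, Equiv.swap_mul_self, mul_one] at h3

/-- Transforming and emulating via `x` commute on inputs of length at least `n`, and completeness
disregards shorter ones. -/
theorem tree_subset_tree_inputTransform (hcomplete : IsCompleteComputerSet Φ)
    (hclosed : ClosedUnderInputTransforms n Φ) (σ : Equiv.Perm (List.Vector Bool n))
    (C : Computer) : tree Φ C ⊆ tree Φ (inputTransform σ C) := fun x hx =>
  hcomplete _ (hclosed.mem σ hx) n _ fun s hs => by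
    change C (x ++ inputMap σ s) = C (inputMap σ (x ++ s))
    rw [inputMap_append_left σ x hs]

theorem tree_inputTransform (hcomplete : IsCompleteComputerSet Φ)
    (hclosed : ClosedUnderInputTransforms n Φ) (σ : Equiv.Perm (List.Vector Bool n))
    (C : Computer) : tree Φ (inputTransform σ C) = tree Φ C := by
  refine (Set.Subset.antisymm (tree_subset_tree_inputTransform hcomplete hclosed σ C) ?_).symm
  have h := tree_subset_tree_inputTransform hcomplete hclosed σ⁻¹ (inputTransform σ C)
  rwa [inputTransform_inputTransform, mul_inv_cancel, inputTransform_one] at h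

-- Both computers have the same tree, hence the same path probabilities; only the output differs,
-- and the permuted bits are those read after step `m`.
open Classical in
theorem stepStringProb_inputTransform (hΦ : IsBranching Φ) (hcomplete : IsCompleteComputerSet Φ)
    (hclosed : ClosedUnderInputTransforms n Φ) (σ : Equiv.Perm (List.Vector Bool n))
    (s : Part Str) (m : ℕ) (C : Φ) :
    stepStringProb Φ (m + n) (inputTransform σ C) s =
      (avg (bitProb Φ) (next Φ))^[m]
        (fun U => pathMean Φ n U fun y => if U.1 (inputMap σ y) = s then 1 else 0) C := by
  rw [stepStringProb_eq_pathMean, pathMean, tree_inputTransform hcomplete hclosed]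
  exact pathMean_add hΦ (G := fun U y => if U (inputMap σ y) = s then 1 else 0)
    (fun U b y hy => by rw [← List.singleton_append, inputMap_append_left σ [b] hy]; rfl) m C

/-- Right multiplication by a swap shows that the sum over `σ` does not depend on `a`, so it may be
averaged over all points. -/
theorem sum_perm_apply {α : Type*} [Fintype α] [DecidableEq α] (f : α → ℝ) (a : α) :
    (Fintype.card α : ℝ) * ∑ σ : Equiv.Perm α, f (σ a)
      = Fintype.card (Equiv.Perm α) * ∑ b, f b := by
  have h1 : ∀ b, ∑ σ : Equiv.Perm α, f (σ b) = ∑ σ : Equiv.Perm α, f (σ a) := fun b =>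
    Fintype.sum_equiv (Equiv.mulRight (Equiv.swap a b)) _ _ fun σ => by simp
  have h2 : ∑ b, ∑ σ : Equiv.Perm α, f (σ b) = ∑ σ : Equiv.Perm α, ∑ b, f b := by
    rw [sum_comm]
    exact sum_congr rfl fun σ _ => Equiv.sum_comp σ f
  simpa [h1] using h2

open Classical in
theorem sum_perm_pathMean (hΦ : IsBranching Φ) (s : Part Str) (U : Φ) :
    ∑ σ : Equiv.Perm (List.Vector Bool n),
      pathMean Φ n U (fun y => if U.1 (inputMap σ y) = s then 1 else 0)
      = Fintype.card (Equiv.Perm (List.Vector Bool n)) * outputFreq n U s := by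
  -- Once summed over `σ`, the integrand is the same for every path, so the path weights only
  -- contribute their total `1`.
  rw [pathMean_sum, ← pathMean_const hΦ n U (_ * _)]
  refine pathMean_congr fun x hx => ?_
  have h1 : ∀ σ : Equiv.Perm (List.Vector Bool n), inputMap σ x = (σ ⟨x, hx⟩).toList :=
    fun σ => inputMap_append σ [] ⟨x, hx⟩
  have h2 := sum_perm_apply (fun y : List.Vector Bool n => if U.1 y.toList = s then (1 : ℝ) else 0)
    ⟨x, hx⟩
  rw [card_vector, Fintype.card_bool] at h2
  push_cast at h2
  simp only [h1, outputFreq, natCast_card_filter]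
  rw [← mul_div_assoc, ← h2]
  field_simp

theorem hasSum_computerProb_mul_outputFreq (hrec : IsPositiveRecurrent Φ)
    (hcomplete : IsCompleteComputerSet Φ) (hclosed : ClosedUnderInputTransforms n Φ)
    {π : Φ → ℝ} {p : ℝ} {s : Part Str} (hp : IsStringProb Φ s p) {D : Φ}
    (hπ : ∀ U, π U = excursionMean (bitProb Φ) (next Φ) D (delta U)) :
    HasSum (fun U : Φ => π U * outputFreq n U s) p := by
  classical
  set G : Equiv.Perm (List.Vector Bool n) → Φ → ℝ := fun σ U =>
    pathMean Φ n U fun y => if U.1 (inputMap σ y) = s then 1 else 0 with hG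
  have hG1 : ∀ σ U, |G σ U| ≤ 1 := fun σ U =>
    abs_pathMean_le hrec.branching n U fun x => by split_ifs <;> simp
  have h1 : ∀ σ, excursionMean (bitProb Φ) (next Φ) D (G σ) = p := fun σ => by
    -- Independence of the start enters here: `p` is also the limit for the walk started at
    -- `I_σ(D)`.
    have h2 := (hp _ (hclosed.mem σ D.2)).comp (tendsto_add_atTop_nat n)
    refine tendsto_nhds_unique (hrec.tendsto_avg_iterate D D (hG1 σ)) (h2.congr fun m => ?_)
    exact stepStringProb_inputTransform hrec.branching hcomplete hclosed σ s m D
  have h2 : ∀ σ, HasSum (fun U => π U * G σ U) p := fun σ => by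
    simp only [hπ]
    rw [← h1 σ]
    exact hasSum_excursionMean (isStochastic_bitProb hrec.branching) (hrec.isErgodicState D)
      (hG1 σ)
  have h3 := hasSum_sum (s := univ) fun σ _ => h2 σ
  simp only [← mul_sum, hG, sum_perm_pathMean hrec.branching, sum_const, card_univ,
    nsmul_eq_mul] at h3
  have hcard : (Fintype.card (Equiv.Perm (List.Vector Bool n)) : ℝ) ≠ 0 :=
    Nat.cast_ne_zero.2 Fintype.card_ne_zero
  refine (hasSum_mul_left_iff hcard).1 ?_
  simpa only [mul_left_comm] using h3

end StationaryAlgProb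

theorem mainTheorem7 (Φ : Set Computer) (n : ℕ)
    (hrec : IsPositiveRecurrent Φ) (hcomplete : IsCompleteComputerSet Φ)
    (hclosed : ClosedUnderInputTransforms n Φ) :
    (∀ U ∈ Φ, IsComputerProb Φ U (computerProb Φ U)) ∧
    ∀ s : Part Str,
      IsStringProb Φ s (stringProb Φ s) ∧
      HasSum (fun U : Φ => computerProb Φ (U : Computer) * outputFreq n (U : Computer) s)
        (stringProb Φ s) := by
  classical
  obtain ⟨D, hD⟩ := hrec.nonempty
  have hU : ∀ U : Φ, IsComputerProb Φ U
      (RandomWalk.excursionMean (bitProb Φ) (next Φ) ⟨D, hD⟩ (RandomWalk.delta U)) := by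
    intro U C hC
    refine (hrec.tendsto_avg_iterate ⟨D, hD⟩ ⟨C, hC⟩ (B := 1) fun e => ?_).congr fun m =>
      (stepProb_eq_avg_iterate hrec.branching m ⟨C, hC⟩ U).symm
    unfold RandomWalk.delta
    split_ifs <;> simp
  have hU' : ∀ U ∈ Φ, IsComputerProb Φ U (computerProb Φ U) := fun U h =>
    Classical.epsilon_spec (p := IsComputerProb Φ U) ⟨_, hU ⟨U, h⟩⟩
  refine ⟨hU', fun s => ?_⟩
  have hs : IsStringProb Φ s (stringProb Φ s) := by
    -- The string probability is the mean of a bounded function of the computer reached, the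
    -- indicator that it outputs `s` on the empty input.
    refine Classical.epsilon_spec (p := IsStringProb Φ s)
      ⟨RandomWalk.excursionMean (bitProb Φ) (next Φ) ⟨D, hD⟩
        fun U => pathMean Φ 0 U fun y => if U.1 y = s then 1 else 0, fun C hC => ?_⟩
    refine (hrec.tendsto_avg_iterate ⟨D, hD⟩ ⟨C, hC⟩ (B := 1) fun e =>
      abs_pathMean_le hrec.branching 0 e fun x => by split_ifs <;> simp).congr fun m => ?_
    rw [stepStringProb_eq_pathMean]
    exact (pathMean_add hrec.branching (n := 0) (G := fun U y => if U y = s then 1 else 0)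
      (fun U b y _ => rfl) m ⟨C, hC⟩).symm
  exact ⟨hs, hasSum_computerProb_mul_outputFreq hrec hcomplete hclosed hs fun U =>
    tendsto_nhds_unique (hU' U U.2 D hD) (hU U D hD)⟩
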